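/- Let $E$ and $F$ be complex Hausdorff locally convex spaces and let $f:E\supseteq\Omega\to F$ be a function on a set $\Omega\subseteq E$. For $u\in E$ let $d_uf(x)=\lim_{t\to0}t^{-1}(f(x+tu)-f(x))$, the limit being over $t\in\mathbb C\setminus\{0\}$ with $x+tu\in\operatorname{dom}f$; its domain consists of those $x\in\operatorname{dom} f$ at which $0$ is a limit point of such $t$ and the limit exists in $F$. Iterating, each stage with its own domain, put $\delta^kf(x;u_1,\dots,u_k)=(d_{u_k}\cdots d_{u_1}f)(x)$. The differential $d^kf(x)$ is defined at those $x$ for which $\delta^kf(x;u_1,\dots,u_k)$ exists for all $u_1,\dots,u_k\in E$ and is multilinear in $(u_1,\dots,u_k)$, and then it is this multilinear map $E^k\to F$. For $k\in\{0,1,2,\dots\}\cup\{\infty\}$ the map $f$ is of Keller class $C^k_\Pi(\mathbb C)$ if $\Omega$ is open and, for every finite $l\le k$, the differential $d^lf$ is defined on all of $\Omega$, each $d^lf(x)$ is a continuous multilinear map, and for all $x\in\Omega$ and all zero neighbourhoods $W$ of $F$ there is a zero neighbourhood $U$ of $E$ such that for all $\varepsilon>0$ there is a zero neighbourhood $V$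 of $E$ with $x+v\in\Omega$ and $(d^lf(x+v)-d^lf(x))[U^l]\subseteq\varepsilon W$ for all $v\in V$. (For $k=0$ this means that $\Omega$ is open and $f$ is continuous.) The space $F$ is Mackey complete if every sequence $(y_n)$ in $F$ converges for which there are a bounded set $B\subseteq F$ and real numbers $\mu_{nm}\to0$ (as $n,m\to\infty$) with $y_n-y_m\in\mu_{nm}B$ for all $n,m$. The map $f$ is holomorphic, $f\in\mathcal H_T$, if $F$ is Mackey complete, $d_uf(x)$ exists for all $x\in\Omega$ and $u\in E$, and $f\in C^0_\Pi(\mathbb C)$. **Theorem 3.8.** $\mathcal H_T\subseteq C^\infty_\Pi(\mathbb C)$: every map $f:E\supseteq\Omega\to F$ that is holomorphic in this sense is of Keller class $C^\infty_\Pi(\mathbb C)$. -/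

import Mathlib

open Filter Topology Set
open scoped Pointwise

/-- A function from a subset `dom` of `E` into `F`.
The values of `toFun` outside `dom` are irrelevant: no notion below depends on them. -/
structure VectorMap (E F : Type*) where
  dom : Set E
  toFun : E → F

namespace VectorMap

section Basic

variable (𝕜 : Type*) [RCLike 𝕜] {E F : Type*}
  [AddCommGroup E] [Module 𝕜 E] [TopologicalSpace E]
  [AddCommGroup F] [Module 𝕜 F] [TopologicalSpace F]

/-- The filter of scalars `t → 0`, with `t ≠ 0` and `x + t u` in the domain of `f`.
It is a proper filter iff `0` is a limit point of `{t ≠ 0 | x + t u ∈ dom f}`. -/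
def dirFilter (f : VectorMap E F) (u x : E) : Filter 𝕜 :=
  𝓝[{t : 𝕜 | t ≠ 0 ∧ x + t • u ∈ f.dom}] 0

/-- The difference quotient `t⁻¹ (f (x + t u) - f x)`. -/
def diffQuot (f : VectorMap E F) (u x : E) (t : 𝕜) : F :=
  t⁻¹ • (f.toFun (x + t • u) - f.toFun x)

/-- The directional derivative `d_u f`, as a function on the set of those `x ∈ dom f` at which
`0` is a limit point of the admissible scalars and the limit of the difference quotients exists. -/
noncomputable def dirDeriv (f : VectorMap E F) (u : E) : VectorMap E F where
  dom := {x | x ∈ f.dom ∧ (f.dirFilter 𝕜 u x).NeBot ∧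
    ∃ y : F, Tendsto (f.diffQuot 𝕜 u x) (f.dirFilter 𝕜 u x) (𝓝 y)}
  toFun := fun x => limUnder (f.dirFilter 𝕜 u x) (f.diffQuot 𝕜 u x)

/-- The iterated directional derivative
`d(u₁, …, u_k) f = d_{u_k} (… (d_{u₁} f) …)`, with its natural domain. -/
noncomputable def iterDirDeriv (f : VectorMap E F) : (k : ℕ) → (Fin k → E) → VectorMap E F
  | 0, _ => f
  | k + 1, u => (iterDirDeriv f k (Fin.init u)).dirDeriv 𝕜 (u (Fin.last k))

/-- The `k`-th variation at `x`: `δᵏ f (x; u₁, …, u_k) = d(u₁, …, u_k) f (x)`, as a function of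
the directions. -/
noncomputable def variation (f : VectorMap E F) (k : ℕ) (x : E) (u : Fin k → E) : F :=
  (f.iterDirDeriv 𝕜 k u).toFun x

/-- The domain of the `k`-th differential `dᵏ f`: the points `x` at which all `k`-fold iterated
directional derivatives exist and depend multilinearly on the directions. For such `x` the value
`dᵏ f (x)` is the multilinear function `f.variation 𝕜 k x`. -/
def differentialDom (f : VectorMap E F) (k : ℕ) : Set E :=
  {x | (∀ u : Fin k → E, x ∈ (f.iterDirDeriv 𝕜 k u).dom) ∧
    ∃ m : MultilinearMap 𝕜 (fun _ : Fin k => E) F, ∀ u, m u = f.variation 𝕜 k x u}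

/-- The Keller class `C_Π^k`, for `k ∈ ℕ ∪ {∞}` (`⊤` is `∞`): the domain is open, for all finite
`l ≤ k` the differential `dˡ f` is defined on the whole domain with continuous multilinear values,
and for every point `x` of the domain and every zero neighbourhood `W` of `F` there is
a zero neighbourhood `U` of `E` such that for every `ε > 0`
one has `(dˡ f (x + v) - dˡ f (x)) [Uˡ] ⊆ ε W` for all `v` close enough to `0`. -/
structure IsKellerPi (k : ℕ∞) (f : VectorMap E F) : Prop where
  isOpen_dom : IsOpen f.dom
  differentialDom_eq : ∀ l : ℕ, (l : ℕ∞) ≤ k → f.differentialDom 𝕜 l = f.dom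
  continuous_variation : ∀ l : ℕ, (l : ℕ∞) ≤ k → ∀ x ∈ f.dom, Continuous (f.variation 𝕜 l x)
  differential_limContinuous : ∀ l : ℕ, (l : ℕ∞) ≤ k → ∀ x ∈ f.dom,
    ∀ W ∈ 𝓝 (0 : F), ∃ U ∈ 𝓝 (0 : E), ∀ ε : ℝ, 0 < ε → ∃ V ∈ 𝓝 (0 : E), ∀ v ∈ V,
      x + v ∈ f.dom ∧ ∀ u : Fin l → E, (∀ i, u i ∈ U) →
        f.variation 𝕜 l (x + v) u - f.variation 𝕜 l x u ∈ (ε : 𝕜) • W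

/-- All directional derivatives exist: `dom (δ f) = dom f × E`. -/
def IsDirectionallyDifferentiable (f : VectorMap E F) : Prop :=
  {p : E × E | p.1 ∈ (f.dirDeriv 𝕜 p.2).dom} = f.dom ×ˢ (univ : Set E)

end Basic

end VectorMap

/-- A sequence is Mackey–Cauchy if there are a (von Neumann) bounded set `B` and real numbers
`μ (n, m) → 0`, as `n, m → ∞`, with `x n - x m ∈ μ (n, m) B`. -/
def IsMackeyCauchy (𝕜 : Type*) [RCLike 𝕜] {F : Type*} [AddCommGroup F] [Module 𝕜 F]
    [TopologicalSpace F] (x : ℕ → F) : Prop :=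
  ∃ B : Set F, Bornology.IsVonNBounded 𝕜 B ∧ ∃ μ : ℕ × ℕ → ℝ, Tendsto μ atTop (𝓝 0) ∧
    ∀ n m : ℕ, x n - x m ∈ (μ (n, m) : 𝕜) • B

/-- A locally convex space is Mackey complete if every Mackey–Cauchy sequence converges. -/
def MackeyComplete (𝕜 : Type*) [RCLike 𝕜] (F : Type*) [AddCommGroup F] [Module 𝕜 F]
    [TopologicalSpace F] : Prop :=
  ∀ x : ℕ → F, IsMackeyCauchy 𝕜 x → ∃ y : F, Tendsto x atTop (𝓝 y)

/-- The class `𝓗_T` of holomorphic maps: the scalars are complex, the target is Mackey complete,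
the map is directionally differentiable, and it is of class `C_Π^0`, i.e. it is continuous on its
open domain (see `VectorMap.isKellerPi_zero_iff`). -/
structure VectorMap.IsHolomorphicT {E F : Type*}
    [AddCommGroup E] [Module ℂ E] [TopologicalSpace E]
    [AddCommGroup F] [Module ℂ F] [TopologicalSpace F] (f : VectorMap E F) : Prop where
  mackeyComplete : MackeyComplete ℂ F
  directionallyDifferentiable : f.IsDirectionallyDifferentiable ℂ
  isKellerPi_zero : f.IsKellerPi ℂ 0

/-- `C_Π^0` consists of the continuous maps with open domain. -/
theorem VectorMap.isKellerPi_zero_iff (𝕜 : Type*) [RCLike 𝕜] {E F : Type*}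
    [AddCommGroup E] [Module 𝕜 E] [TopologicalSpace E] [IsTopologicalAddGroup E]
    [AddCommGroup F] [Module 𝕜 F] [TopologicalSpace F] [IsTopologicalAddGroup F]
    [ContinuousSMul 𝕜 F] (f : VectorMap E F) :
    f.IsKellerPi 𝕜 0 ↔ IsOpen f.dom ∧ ContinuousOn f.toFun f.dom := by
  have key : ∀ x, Tendsto (fun v : E => x + v) (𝓝 0) (𝓝 x) := fun x => by
    have h : Continuous fun v : E => x + v := by fun_prop
    simpa using h.tendsto 0
  constructor
  · intro h
    refine ⟨h.isOpen_dom, fun x hx => ContinuousAt.continuousWithinAt ?_⟩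
    have h1 : Tendsto (fun v : E => f.toFun (x + v) - f.toFun x) (𝓝 0) (𝓝 0) := by
      intro W hW
      obtain ⟨U, -, hU⟩ := h.differential_limContinuous 0 (by simp) x hx W hW
      obtain ⟨V, hV, hVW⟩ := hU 1 one_pos
      change _ ∈ 𝓝 (0 : E)
      filter_upwards [hV] with v hv
      have := (hVW v hv).2 Fin.elim0 (fun i => i.elim0)
      simpa [variation, iterDirDeriv] using this
    have h2 : Tendsto (fun y : E => y - x) (𝓝 x) (𝓝 0) := by
      have h : Continuous fun y : E => y - x := by fun_prop
      simpa using h.tendsto x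
    have h3 := (h1.comp h2).add_const (f.toFun x)
    simpa [ContinuousAt, Function.comp_def] using h3
  · rintro ⟨ho, hc⟩
    have hl : ∀ l : ℕ, (l : ℕ∞) ≤ 0 → l = 0 := fun l h => by simpa using h
    refine ⟨ho, fun l h => ?_, fun l h x hx => ?_, fun l h x hx W hW => ?_⟩ <;>
      obtain rfl := hl l h
    · ext x
      constructor
      · exact fun hx => hx.1 Fin.elim0
      · exact fun hx => ⟨fun _ => hx, MultilinearMap.constOfIsEmpty 𝕜 _ (f.toFun x), fun _ => rfl⟩
    · exact (continuous_const : Continuous fun _ : Fin 0 → E => f.toFun x)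
    · refine ⟨univ, univ_mem, fun ε hε => ?_⟩
      have hε' : (ε : 𝕜) ≠ 0 := by exact_mod_cast hε.ne'
      have hW' : (ε : 𝕜) • W ∈ 𝓝 (0 : F) := by simpa using smul_mem_nhds_smul₀ hε' hW
      have h1 : Tendsto (fun v : E => f.toFun (x + v) - f.toFun x) (𝓝 0) (𝓝 0) := by
        have h := ((hc.continuousAt (ho.mem_nhds hx)).tendsto.comp (key x)).sub_const (f.toFun x)
        simpa [Function.comp_def] using h
      refine ⟨_, inter_mem (h1 hW') ((key x) (ho.mem_nhds hx)), fun v hv => ⟨hv.2, fun u _ => ?_⟩⟩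
      exact hv.1

/-! Everything rests on the Schwarz lemma on complex discs, transported to `F` by Hahn–Banach. If `p
∘ f ≤ M` along a disc of radius `R`, then after composing with any functional dominated by `p`,
Schwarz bounds increments by `2M/R * ‖z‖`; applied to the slope as well, it places difference
quotients within `4M/R² * ‖z‖` of the scalar derivative. Hence the quotients of `f` form a
Mackey–Cauchy family, and completeness of `F` produces `d_u f`.

The induction runs over `IsWeaklyHolomorphic`, a class preserved by `d_u`
(`IsWeaklyHolomorphic.dirDeriv`), so all iterated derivatives live on the whole domain. The bound
`iterDirDeriv_bound`, uniform in base point and directions, makes each `dᵏf(x)` continuous; one more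
use of Schwarz turns it into the limit condition, with `U` independent of `ε`. -/

/-! ### Seminorms and Hahn–Banach. -/

section LocallyConvex

variable {E : Type*} [AddCommGroup E] [Module ℂ E] [TopologicalSpace E]

/-- A real locally convex topology on a complex topological vector space is given by complex
seminorms. -/
theorem polynormableSpace_complex [IsTopologicalAddGroup E] [ContinuousSMul ℂ E]
    [LocallyConvexSpace ℝ E] : PolynormableSpace ℂ E := by
  open scoped ComplexOrder in
  have h : LocallyConvexSpace ℂ E := by
    rw [locallyConvexSpace_iff_exists_convex_subset_zero]
    intro U hU
    obtain ⟨S, hS, hc, hSU⟩ :=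
      (locallyConvexSpace_iff_exists_convex_subset_zero ℝ E).1 inferInstance U hU
    exact ⟨S, hS, convex_of_nonneg_surjective_algebraMap _
      (fun z hz => RCLike.nonneg_iff_exists_ofReal.1 hz) hc, hSU⟩
  have := IsScalarTower.continuousSMul (M := ℝ) (α := E) ℂ
  exact LocallyConvexSpace.toPolynormableSpace

variable [PolynormableSpace ℂ E]

theorem exists_seminorm_ball_subset {U : Set E} (hU : U ∈ 𝓝 (0 : E)) :
    ∃ q : Seminorm ℂ E, Continuous q ∧ ∃ r : ℝ, 0 < r ∧ ∀ v, q v < r → v ∈ U := by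
  obtain ⟨s, r, hr, h⟩ := ((PolynormableSpace.withSeminorms ℂ E).mem_nhds_iff 0 U).1 hU
  have hc : Continuous ⇑(s.sup fun p : {p : Seminorm ℂ E // Continuous p} => p.1) := by
    clear h
    induction s using Finset.cons_induction with
    | empty => exact continuous_const
    | cons a s ha ih =>
      rw [Finset.sup_cons]
      exact a.2.sup ih
  exact ⟨_, hc, r, hr, fun v hv => h (by simpa [Seminorm.mem_ball] using hv)⟩

theorem tendsto_of_forall_seminorm [IsTopologicalAddGroup E] {ι : Type*} {l : Filter ι}
    {g : ι → E} {y : E}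
    (h : ∀ p : Seminorm ℂ E, Continuous p → ∀ ε : ℝ, 0 < ε → ∀ᶠ i in l, p (g i - y) < ε) :
    Tendsto g l (𝓝 y) :=
  ((PolynormableSpace.withSeminorms ℂ E).tendsto_nhds g y).2 fun p => h p.1 p.2

omit [PolynormableSpace ℂ E] in
theorem tendsto_seminorm_sub [IsTopologicalAddGroup E] {ι : Type*} {l : Filter ι}
    {g : ι → E} {y : E} (h : Tendsto g l (𝓝 y)) {p : Seminorm ℂ E} (hp : Continuous p) :
    Tendsto (fun i => p (g i - y)) l (𝓝 0) := by
  have := (hp.tendsto 0).comp (tendsto_sub_nhds_zero_iff.2 h)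
  simpa [Function.comp_def] using this

/-- Hahn–Banach: `t • y ↦ p y * t` is dominated by `p` on the line `ℂ ∙ y`, and a dominated
extension attains `p y` at `y`. -/
theorem seminorm_le_of_forall_dual {p : Seminorm ℂ E} (hp : Continuous p) {y : E} {C : ℝ}
    (h : ∀ φ : StrongDual ℂ E, (∀ z, ‖φ z‖ ≤ p z) → ‖φ y‖ ≤ C) : p y ≤ C := by
  by_cases hy : p y = 0
  · rw [hy]
    -- The zero functional shows `0 ≤ C`.
    exact (norm_nonneg _).trans (h 0 fun z => by simp)
  have hy0 : y ≠ 0 := by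
    rintro rfl
    exact hy (map_zero p)
  let e := LinearEquiv.toSpanNonzeroSingleton ℂ E y hy0
  let c : Module.Dual ℂ (ℂ ∙ y) := (p y : ℂ) • (e.symm : (ℂ ∙ y) →ₗ[ℂ] ℂ)
  have hc : ∀ t : ℂ, c (e t) = p y * t := fun t => by simp [c]
  obtain ⟨φ, h1, h2⟩ := c.exists_continuous_extension_of_le_seminorm (p := p) _ hp (by
    intro x
    obtain ⟨t, rfl⟩ := e.surjective x
    rw [hc]
    simp [e, map_smul_eq_mul, mul_comm, abs_of_nonneg (apply_nonneg p y)])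
  have h3 := h φ h2
  have h4 : φ y = p y := by
    have := h1 (e 1)
    rw [hc] at this
    simpa [e] using this
  rw [h4] at h3
  exact (le_abs_self _).trans (by simpa using h3)

end LocallyConvex

/-! ### Scalar Schwarz estimates. -/

section Schwarz

open Metric

theorem norm_sub_le_of_norm_le_ball {h : ℂ → ℂ} {R M : ℝ}
    (hd : DifferentiableOn ℂ h (ball 0 R)) (hM : ∀ z ∈ ball (0 : ℂ) R, ‖h z‖ ≤ M)
    {z : ℂ} (hz : z ∈ ball (0 : ℂ) R) : ‖h z - h 0‖ ≤ 2 * M / R * ‖z‖ := by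
  have hR : 0 < R := nonempty_ball.1 ⟨z, hz⟩
  have := Complex.dist_le_div_mul_dist_of_mapsTo_ball (R₂ := 2 * M) hd (fun w hw => by
    rw [mem_closedBall, dist_eq_norm]
    linarith [norm_sub_le (h w) (h 0), hM w hw, hM 0 (mem_ball_self hR)]) hz
  simpa [dist_eq_norm] using this

/-- By Schwarz the slope is bounded by `2M/R`, so the preceding estimate applies to it and gives
`2(2M/R)/R`. -/
theorem norm_slope_sub_deriv_le_of_norm_le_ball {h : ℂ → ℂ} {R M : ℝ}
    (hd : DifferentiableOn ℂ h (ball 0 R)) (hM : ∀ z ∈ ball (0 : ℂ) R, ‖h z‖ ≤ M)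
    {z : ℂ} (hz : z ∈ ball (0 : ℂ) R) (hz0 : z ≠ 0) :
    ‖z⁻¹ * (h z - h 0) - deriv h 0‖ ≤ 4 * M / R ^ 2 * ‖z‖ := by
  have hR : 0 < R := nonempty_ball.1 ⟨z, hz⟩
  have hd' : DifferentiableOn ℂ (dslope h 0) (ball 0 R) :=
    (Complex.differentiableOn_dslope (isOpen_ball.mem_nhds (mem_ball_self hR))).2 hd
  have := norm_sub_le_of_norm_le_ball hd' (M := 2 * M / R) (fun w hw =>
    Complex.norm_dslope_le_div_of_mapsTo_ball hd (fun w hw => by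
      rw [mem_closedBall, dist_eq_norm]
      linarith [norm_sub_le (h w) (h 0), hM w hw, hM 0 (mem_ball_self hR)]) hw) hz
  rw [dslope_same, dslope_of_ne _ hz0, slope_def_module, sub_zero, smul_eq_mul] at this
  refine this.trans_eq ?_
  field_simp
  ring

end Schwarz

/-! ### Weakly holomorphic maps along complex lines. -/

namespace VectorMap

variable {E F : Type*} [AddCommGroup E] [Module ℂ E] [TopologicalSpace E]
  [AddCommGroup F] [Module ℂ F] [TopologicalSpace F]

/-- Maps with open domain that are locally bounded and holomorphic along complex lines, both in
the weak sense. -/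
structure IsWeaklyHolomorphic (f : VectorMap E F) : Prop where
  isOpen_dom : IsOpen f.dom
  differentiableAt_line : ∀ (φ : StrongDual ℂ F), ∀ x ∈ f.dom, ∀ u : E,
    DifferentiableAt ℂ (fun z : ℂ => φ (f.toFun (x + z • u))) 0
  locally_bounded : ∀ p : Seminorm ℂ F, Continuous p → ∀ x ∈ f.dom,
    ∃ q : Seminorm ℂ E, Continuous q ∧ ∃ r : ℝ, 0 < r ∧ ∃ M : ℝ, ∀ v, q v < r →
      x + v ∈ f.dom ∧ p (f.toFun (x + v)) ≤ M

omit [TopologicalSpace E] [TopologicalSpace F] in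
theorem mem_dom_line {f : VectorMap E F} {x v u : E} {p : Seminorm ℂ F} {q : Seminorm ℂ E}
    {r M R : ℝ} (h : ∀ v, q v < r → x + v ∈ f.dom ∧ p (f.toFun (x + v)) ≤ M)
    (hr : q v + R * q u < r) (z : ℂ) (hz : z ∈ Metric.ball (0 : ℂ) R) :
    x + v + z • u ∈ f.dom ∧ p (f.toFun (x + v + z • u)) ≤ M := by
  rw [add_assoc]
  refine h _ ((map_add_le_add q _ _).trans_lt (lt_of_le_of_lt ?_ hr))
  rw [map_smul_eq_mul]
  have : ‖z‖ ≤ R := by simpa using (mem_ball_zero_iff.1 hz).le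
  gcongr

section Lines

variable {f : VectorMap E F} (hf : f.IsWeaklyHolomorphic) {x u : E} {R M : ℝ}
include hf

theorem IsWeaklyHolomorphic.differentiableOn_line (φ : StrongDual ℂ F) {s : Set ℂ}
    (h : ∀ z ∈ s, x + z • u ∈ f.dom) :
    DifferentiableOn ℂ (fun z : ℂ => φ (f.toFun (x + z • u))) s := by
  intro z hz
  have h1 := hf.differentiableAt_line φ _ (h z hz) u
  have h2 : DifferentiableAt ℂ (fun w : ℂ => w - z) z := by fun_prop
  have h3 := DifferentiableAt.comp z (f := fun w : ℂ => w - z)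
    (g := fun w : ℂ => φ (f.toFun (x + z • u + w • u))) (by simpa using h1) h2
  refine DifferentiableAt.differentiableWithinAt ?_
  refine h3.congr_of_eventuallyEq (.of_forall fun w => ?_)
  simp [sub_smul, add_assoc]

variable [PolynormableSpace ℂ F] {p : Seminorm ℂ F} (hp : Continuous p)
  (h : ∀ z ∈ Metric.ball (0 : ℂ) R, x + z • u ∈ f.dom ∧ p (f.toFun (x + z • u)) ≤ M)
include hp h

theorem IsWeaklyHolomorphic.seminorm_sub_le {z : ℂ} (hz : z ∈ Metric.ball (0 : ℂ) R) :
    p (f.toFun (x + z • u) - f.toFun x) ≤ 2 * M / R * ‖z‖ := by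
  refine seminorm_le_of_forall_dual hp fun φ hφ => ?_
  have := norm_sub_le_of_norm_le_ball (hf.differentiableOn_line φ fun z hz => (h z hz).1)
    (fun z hz => (hφ _).trans (h z hz).2) hz
  simpa using this

/-- Both quotients are compared with the derivative of `φ ∘ f`, which then cancels; no derivative in
`F` is needed yet. -/
theorem IsWeaklyHolomorphic.seminorm_diffQuot_sub_le {z w : ℂ} (hz : z ∈ Metric.ball (0 : ℂ) R)
    (hz0 : z ≠ 0) (hw : w ∈ Metric.ball (0 : ℂ) R) (hw0 : w ≠ 0) :
    p (f.diffQuot ℂ u x z - f.diffQuot ℂ u x w) ≤ 4 * M / R ^ 2 * (‖z‖ + ‖w‖) := by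
  refine seminorm_le_of_forall_dual hp fun φ hφ => ?_
  have hd := hf.differentiableOn_line φ fun z hz => (h z hz).1
  have hb : ∀ z ∈ Metric.ball (0 : ℂ) R, ‖φ (f.toFun (x + z • u))‖ ≤ M :=
    fun z hz => (hφ _).trans (h z hz).2
  have h1 := norm_slope_sub_deriv_le_of_norm_le_ball hd hb hz hz0
  have h2 := norm_slope_sub_deriv_le_of_norm_le_ball hd hb hw hw0
  have h3 := (norm_sub_le _ _).trans (add_le_add h1 h2)
  simp only [sub_sub_sub_cancel_right, zero_smul, add_zero] at h3
  simpa [diffQuot, mul_add] using h3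

end Lines

end VectorMap

/-! ### Continuity and existence of directional derivatives. -/

namespace VectorMap

variable {E F : Type*} [AddCommGroup E] [Module ℂ E] [TopologicalSpace E]
  [IsTopologicalAddGroup E] [ContinuousSMul ℂ E]
  [AddCommGroup F] [Module ℂ F] [TopologicalSpace F]

omit [AddCommGroup F] [Module ℂ F] [TopologicalSpace F] in
theorem exists_ball_line_mem_dom {f : VectorMap E F} (ho : IsOpen f.dom) {x : E} (hx : x ∈ f.dom)
    (u : E) : ∃ R : ℝ, 0 < R ∧ ∀ z ∈ Metric.closedBall (0 : ℂ) R, x + z • u ∈ f.dom := by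
  have hc : Continuous fun z : ℂ => x + z • u := by fun_prop
  have : (fun z : ℂ => x + z • u) ⁻¹' f.dom ∈ 𝓝 (0 : ℂ) :=
    hc.continuousAt (ho.mem_nhds (by simpa using hx))
  exact Metric.nhds_basis_closedBall.mem_iff.1 this

omit [AddCommGroup F] [Module ℂ F] [TopologicalSpace F] in
theorem dirFilter_eq {f : VectorMap E F} (ho : IsOpen f.dom) {x : E} (hx : x ∈ f.dom) (u : E) :
    f.dirFilter ℂ u x = 𝓝[≠] 0 := by
  obtain ⟨R, hR, h⟩ := exists_ball_line_mem_dom ho hx u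
  rw [dirFilter, ofPred_and]
  exact nhdsWithin_inter_of_mem' (nhdsWithin_le_nhds
    (mem_of_superset (Metric.closedBall_mem_nhds 0 hR) h))

variable {f : VectorMap E F} (hf : f.IsWeaklyHolomorphic)

omit [IsTopologicalAddGroup E] [ContinuousSMul ℂ E] in
include hf in
-- Schwarz on the disc of radius `R` in direction `v`, evaluated at `z = 1`: small `v` admits large
-- `R`, hence a small increment.
theorem IsWeaklyHolomorphic.seminorm_sub_le_of_ball [PolynormableSpace ℂ F] {x v : E}
    {p : Seminorm ℂ F} (hp : Continuous p) {q : Seminorm ℂ E} {r M R : ℝ}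
    (h : ∀ v, q v < r → x + v ∈ f.dom ∧ p (f.toFun (x + v)) ≤ M)
    (hR : 1 < R) (hv : R * q v < r) :
    p (f.toFun (x + v) - f.toFun x) ≤ 2 * M / R := by
  have := hf.seminorm_sub_le hp (x := x) (u := v) (R := R) (M := M) (fun z hz => by
    simpa using mem_dom_line (v := 0) (u := v) (R := R) h (by simpa using hv) z hz)
    (z := 1) (by simpa using hR)
  simpa using this

omit [IsTopologicalAddGroup E] [ContinuousSMul ℂ E] in
include hf in
theorem IsWeaklyHolomorphic.eventually_seminorm_sub_lt [PolynormableSpace ℂ F] {x : E}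
    (hx : x ∈ f.dom) {p : Seminorm ℂ F} (hp : Continuous p) {ε : ℝ} (hε : 0 < ε) :
    ∀ᶠ v in 𝓝 (0 : E), p (f.toFun (x + v) - f.toFun x) < ε := by
  obtain ⟨q, hq, r, hr, M, h⟩ := hf.locally_bounded p hp x hx
  obtain ⟨R, hR1, hR2⟩ : ∃ R : ℝ, 1 < R ∧ 2 * M / R < ε :=
    ((eventually_gt_atTop 1).and
      ((tendsto_const_nhds.div_atTop tendsto_id).eventually_lt_const hε)).exists
  have : ∀ᶠ v in 𝓝 (0 : E), R * q v < r := by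
    have hc : Continuous fun v => R * q v := by fun_prop
    exact (hc.tendsto 0).eventually_lt_const (by simpa using hr)
  filter_upwards [this] with v hv
  exact (hf.seminorm_sub_le_of_ball hp h hR1 hv).trans_lt hR2

variable [IsTopologicalAddGroup F] [PolynormableSpace ℂ F]

omit [ContinuousSMul ℂ E] in
include hf in
theorem IsWeaklyHolomorphic.continuousOn : ContinuousOn f.toFun f.dom := by
  intro x hx
  refine ContinuousAt.continuousWithinAt (tendsto_of_forall_seminorm fun p hp ε hε => ?_)
  have h := hf.eventually_seminorm_sub_lt hx hp hε
  have h2 : Tendsto (fun y : E => y - x) (𝓝 x) (𝓝 0) := by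
    have h : Continuous fun y : E => y - x := by fun_prop
    simpa using h.tendsto x
  simpa using h2.eventually h

include hf in
-- Compactness of a closed disc allows one `R` for all seminorms, whereas the radius in
-- `locally_bounded` depends on `p`.
theorem IsWeaklyHolomorphic.exists_ball_line {x : E} (hx : x ∈ f.dom) (u : E) :
    ∃ R : ℝ, 0 < R ∧ ∀ p : Seminorm ℂ F, Continuous p → ∃ M : ℝ, 0 ≤ M ∧
      ∀ z ∈ Metric.ball (0 : ℂ) R, x + z • u ∈ f.dom ∧ p (f.toFun (x + z • u)) ≤ M := by
  obtain ⟨R, hR, h⟩ := exists_ball_line_mem_dom hf.isOpen_dom hx u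
  refine ⟨R, hR, fun p hp => ?_⟩
  have hc : ContinuousOn (fun z : ℂ => p (f.toFun (x + z • u))) (Metric.closedBall 0 R) :=
    hp.comp_continuousOn (hf.continuousOn.comp (by fun_prop) h)
  obtain ⟨M, hM⟩ := (isCompact_closedBall (0 : ℂ) R).exists_bound_of_continuousOn hc
  refine ⟨M, (norm_nonneg _).trans (hM 0 (by simpa using hR.le)), fun z hz => ?_⟩
  have hz' := Metric.ball_subset_closedBall hz
  exact ⟨h z hz', (le_abs_self _).trans (hM z hz')⟩

include hf in
/-- Along a line the difference quotients form a Mackey–Cauchy family, so they converge if the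
target is Mackey complete. -/
theorem IsWeaklyHolomorphic.exists_tendsto_diffQuot (hF : MackeyComplete ℂ F) {x : E}
    (hx : x ∈ f.dom) (u : E) : ∃ y : F, Tendsto (f.diffQuot ℂ u x) (𝓝[≠] 0) (𝓝 y) := by
  obtain ⟨R, hR, hM⟩ := hf.exists_ball_line hx u
  -- The shift by 2 keeps every `w n` strictly inside the ball.
  set w : ℕ → ℂ := fun n => ((R / (n + 2) : ℝ) : ℂ) with hw
  have hwn : ∀ n, ‖w n‖ = R / (n + 2) := fun n => by
    rw [hw, Complex.norm_real, Real.norm_of_nonneg (by positivity)]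
  have hwpos : ∀ n, 0 < ‖w n‖ := fun n => by rw [hwn]; positivity
  have hw0 : ∀ n, w n ≠ 0 := fun n => norm_pos_iff.1 (hwpos n)
  have hwR : ∀ n, w n ∈ Metric.ball (0 : ℂ) R := fun n => by
    rw [mem_ball_zero_iff, hwn]
    exact div_lt_self hR (by linarith [n.cast_nonneg (α := ℝ)])
  have hwt : Tendsto (fun n => ‖w n‖) atTop (𝓝 0) := by
    simp_rw [hwn]
    exact tendsto_const_nhds.div_atTop
      (tendsto_atTop_add_const_right _ _ tendsto_natCast_atTop_atTop)
  have hcauchy : IsMackeyCauchy ℂ fun n => f.diffQuot ℂ u x (w n) := by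
    -- The bounded set consists of the differences normalised by `‖w n‖ + ‖w m‖`; every seminorm of
    -- these is at most `4M/R²`.
    refine ⟨range fun k : ℕ × ℕ => ((‖w k.1‖ + ‖w k.2‖ : ℝ) : ℂ)⁻¹ •
      (f.diffQuot ℂ u x (w k.1) - f.diffQuot ℂ u x (w k.2)), ?_,
      fun k => ‖w k.1‖ + ‖w k.2‖, ?_, fun n m => ?_⟩
    · rw [(PolynormableSpace.withSeminorms ℂ F).isVonNBounded_iff_seminorm_bounded]
      rintro ⟨p, hp⟩
      obtain ⟨M, hM0, h⟩ := hM p hp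
      refine ⟨4 * M / R ^ 2 + 1, by positivity, ?_⟩
      rintro _ ⟨k, rfl⟩
      have h1 := hf.seminorm_diffQuot_sub_le hp h (hwR k.1) (hw0 k.1) (hwR k.2) (hw0 k.2)
      have h2 : 0 < ‖w k.1‖ + ‖w k.2‖ := add_pos (hwpos _) (hwpos _)
      dsimp only
      rw [map_smul_eq_mul, norm_inv, Complex.norm_real, Real.norm_of_nonneg h2.le,
        inv_mul_lt_iff₀ h2]
      nlinarith
    · rw [← prod_atTop_atTop_eq]
      simpa using (hwt.comp tendsto_fst).add (hwt.comp tendsto_snd)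
    · have h2 : (((‖w n‖ + ‖w m‖ : ℝ) : ℂ)) ≠ 0 := by
        exact_mod_cast (add_pos (hwpos n) (hwpos m)).ne'
      exact ⟨_, ⟨(n, m), rfl⟩, smul_inv_smul₀ h2 _⟩
  obtain ⟨y, hy⟩ := hF _ hcauchy
  refine ⟨y, tendsto_of_forall_seminorm fun p hp ε hε => ?_⟩
  obtain ⟨M, hM0, h⟩ := hM p hp
  -- Letting `w n → 0` in the two-quotient estimate passes from the sequence to all `z`.
  have hle : ∀ z ∈ Metric.ball (0 : ℂ) R, z ≠ 0 →
      p (f.diffQuot ℂ u x z - y) ≤ 4 * M / R ^ 2 * ‖z‖ := by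
    intro z hz hz0
    have hlim : Tendsto (fun n => 4 * M / R ^ 2 * (‖z‖ + ‖w n‖) +
        p (f.diffQuot ℂ u x (w n) - y)) atTop (𝓝 (4 * M / R ^ 2 * (‖z‖ + 0) + 0)) :=
      ((hwt.const_add _).const_mul _).add (tendsto_seminorm_sub hy hp)
    rw [add_zero, add_zero] at hlim
    refine ge_of_tendsto' hlim fun n => ?_
    have h1 := hf.seminorm_diffQuot_sub_le hp h hz hz0 (hwR n) (hw0 n)
    have h2 := map_add_le_add p (f.diffQuot ℂ u x z - f.diffQuot ℂ u x (w n))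
      (f.diffQuot ℂ u x (w n) - y)
    rw [sub_add_sub_cancel] at h2
    linarith
  have hlim : Tendsto (fun z : ℂ => 4 * M / R ^ 2 * ‖z‖) (𝓝[≠] 0) (𝓝 0) := by
    have hc : Continuous fun z : ℂ => 4 * M / R ^ 2 * ‖z‖ := by fun_prop
    simpa using (hc.tendsto 0).mono_left nhdsWithin_le_nhds
  filter_upwards [hlim.eventually_lt_const hε, self_mem_nhdsWithin,
    nhdsWithin_le_nhds (Metric.ball_mem_nhds 0 hR)] with z h1 h2 h3
  exact (hle z h3 h2).trans_lt h1

section DirDeriv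

variable (hF : MackeyComplete ℂ F)
include hf hF

theorem IsWeaklyHolomorphic.tendsto_diffQuot {x : E} (hx : x ∈ f.dom) (u : E) :
    Tendsto (f.diffQuot ℂ u x) (𝓝[≠] 0) (𝓝 ((f.dirDeriv ℂ u).toFun x)) := by
  change Tendsto _ _ (𝓝 (limUnder (f.dirFilter ℂ u x) _))
  rw [dirFilter_eq hf.isOpen_dom hx]
  exact tendsto_nhds_limUnder (hf.exists_tendsto_diffQuot hF hx u)

theorem IsWeaklyHolomorphic.dom_dirDeriv (u : E) : (f.dirDeriv ℂ u).dom = f.dom := by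
  refine Subset.antisymm (fun x hx => hx.1) fun x hx => ⟨hx, ?_⟩
  rw [dirFilter_eq hf.isOpen_dom hx]
  exact ⟨inferInstance, hf.exists_tendsto_diffQuot hF hx u⟩

section

variable {x u : E} {R M : ℝ} {p : Seminorm ℂ F} (hp : Continuous p)
  (h : ∀ z ∈ Metric.ball (0 : ℂ) R, x + z • u ∈ f.dom ∧ p (f.toFun (x + z • u)) ≤ M)
include hp h

theorem IsWeaklyHolomorphic.seminorm_dirDeriv_le (hR : 0 < R) :
    p ((f.dirDeriv ℂ u).toFun x) ≤ 2 * M / R := by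
  have hx : x ∈ f.dom := by simpa using (h 0 (by simpa using hR)).1
  refine le_of_tendsto ((hp.tendsto _).comp (hf.tendsto_diffQuot hF hx u)) ?_
  filter_upwards [self_mem_nhdsWithin, nhdsWithin_le_nhds (Metric.ball_mem_nhds 0 hR)] with z h0 hz
  have := hf.seminorm_sub_le hp h hz
  rw [Function.comp_apply, diffQuot, map_smul_eq_mul, norm_inv,
    inv_mul_le_iff₀ (norm_pos_iff.2 h0)]
  linarith

theorem IsWeaklyHolomorphic.seminorm_diffQuot_sub_dirDeriv_le {z : ℂ}
    (hz : z ∈ Metric.ball (0 : ℂ) R) (hz0 : z ≠ 0) :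
    p (f.diffQuot ℂ u x z - (f.dirDeriv ℂ u).toFun x) ≤ 4 * M / R ^ 2 * ‖z‖ := by
  have hR : 0 < R := Metric.nonempty_ball.1 ⟨z, hz⟩
  have hx : x ∈ f.dom := by simpa using (h 0 (by simpa using hR)).1
  have h1 : Tendsto (fun w : ℂ => 4 * M / R ^ 2 * (‖z‖ + ‖w‖)) (𝓝[≠] 0)
      (𝓝 (4 * M / R ^ 2 * ‖z‖)) := by
    have hc : Continuous fun w : ℂ => 4 * M / R ^ 2 * (‖z‖ + ‖w‖) := by fun_prop
    simpa using (hc.tendsto 0).mono_left nhdsWithin_le_nhds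
  refine le_of_tendsto_of_tendsto ((hp.tendsto _).comp
    (tendsto_const_nhds.sub (hf.tendsto_diffQuot hF hx u))) h1 ?_
  filter_upwards [self_mem_nhdsWithin, nhdsWithin_le_nhds (Metric.ball_mem_nhds 0 hR)] with w h0 hw
  exact hf.seminorm_diffQuot_sub_le hp h hz hz0 hw h0

end

end DirDeriv

end VectorMap

/-! ### Stability under differentiation; linearity in the direction. -/

namespace VectorMap

variable {E F : Type*} [AddCommGroup E] [Module ℂ E] [TopologicalSpace E]
  [IsTopologicalAddGroup E] [ContinuousSMul ℂ E]
  [AddCommGroup F] [Module ℂ F] [TopologicalSpace F]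
  {f g₁ g₂ : VectorMap E F}

omit [IsTopologicalAddGroup E] [ContinuousSMul ℂ E] in
theorem IsWeaklyHolomorphic.exists_ball_plane (hf : f.IsWeaklyHolomorphic) {x : E}
    (hx : x ∈ f.dom) (u v : E) {p : Seminorm ℂ F} (hp : Continuous p) :
    ∃ R : ℝ, 0 < R ∧ ∃ M : ℝ, ∀ w ∈ Metric.ball (0 : ℂ) R, ∀ z ∈ Metric.ball (0 : ℂ) R,
      x + w • v + z • u ∈ f.dom ∧ p (f.toFun (x + w • v + z • u)) ≤ M := by
  obtain ⟨q, hq, r, hr, M, h⟩ := hf.locally_bounded p hp x hx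
  have h1 : 0 ≤ q u := apply_nonneg q u
  have h2 : 0 ≤ q v := apply_nonneg q v
  have h3 : 0 < r / (q u + q v + 1) := by positivity
  refine ⟨_, h3, M, fun w hw => mem_dom_line h ?_⟩
  have hw' := (mem_ball_zero_iff.1 hw).le
  have h4 : r / (q u + q v + 1) * (q u + q v + 1) = r := by field_simp
  rw [map_smul_eq_mul]
  nlinarith [mul_le_mul_of_nonneg_right hw' h2]

variable [IsTopologicalAddGroup F] [PolynormableSpace ℂ F]

/-- Along a line the quotients are holomorphic in the base point and converge uniformly, so
Weierstrass applies to the limit. The local bound is a Cauchy estimate. -/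
theorem IsWeaklyHolomorphic.dirDeriv (hf : f.IsWeaklyHolomorphic) (hF : MackeyComplete ℂ F)
    (u : E) : (f.dirDeriv ℂ u).IsWeaklyHolomorphic where
  isOpen_dom := by
    rw [hf.dom_dirDeriv hF]
    exact hf.isOpen_dom
  differentiableAt_line φ x hx v := by
    rw [hf.dom_dirDeriv hF] at hx
    have hp : Continuous φ.toSeminorm := φ.continuous.norm
    obtain ⟨R, hR, M, h⟩ := hf.exists_ball_plane hx u v hp
    suffices DifferentiableOn ℂ (fun w : ℂ => φ ((f.dirDeriv ℂ u).toFun (x + w • v)))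
        (Metric.ball 0 R) from this.differentiableAt (Metric.ball_mem_nhds 0 hR)
    have hu : TendstoUniformlyOn (fun z w : ℂ => φ (f.diffQuot ℂ u (x + w • v) z))
        (fun w : ℂ => φ ((f.dirDeriv ℂ u).toFun (x + w • v))) (𝓝[≠] 0) (Metric.ball 0 R) := by
      rw [Metric.tendstoUniformlyOn_iff]
      intro ε hε
      have hlim : Tendsto (fun z : ℂ => 4 * M / R ^ 2 * ‖z‖) (𝓝[≠] 0) (𝓝 0) := by
        have hc : Continuous fun z : ℂ => 4 * M / R ^ 2 * ‖z‖ := by fun_prop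
        simpa using (hc.tendsto 0).mono_left nhdsWithin_le_nhds
      filter_upwards [hlim.eventually_lt_const hε, self_mem_nhdsWithin,
        nhdsWithin_le_nhds (Metric.ball_mem_nhds 0 hR)] with z h1 h2 h3 w hw
      rw [dist_comm, dist_eq_norm, ← map_sub]
      exact (hf.seminorm_diffQuot_sub_dirDeriv_le hF hp (h w hw) h3 h2).trans_lt h1
    refine hu.tendstoLocallyUniformlyOn.differentiableOn ?_ Metric.isOpen_ball
    filter_upwards [nhdsWithin_le_nhds (Metric.ball_mem_nhds 0 hR)] with z hz
    simp only [diffQuot, map_smul, map_sub, smul_eq_mul]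
    refine DifferentiableOn.const_mul (DifferentiableOn.sub ?_ ?_) _
    · simp only [add_right_comm x _ (z • u)]
      refine hf.differentiableOn_line φ fun w hw => ?_
      rw [add_right_comm]
      exact (h w hw z hz).1
    · refine hf.differentiableOn_line φ fun w hw => ?_
      simpa using (h w hw 0 (Metric.mem_ball_self hR)).1
  locally_bounded p hp x hx := by
    rw [hf.dom_dirDeriv hF] at hx ⊢
    obtain ⟨q, hq, r, hr, M, h⟩ := hf.locally_bounded p hp x hx
    have h1 : 0 ≤ q u := apply_nonneg q u
    -- Half of `r` is spent on moving the base point, half on the disc in direction `u`; the `+ 1`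
    -- covers `q u = 0`.
    have h3 : 0 < r / 2 / (q u + 1) := by positivity
    refine ⟨q, hq, r / 2, by positivity, 2 * M / (r / 2 / (q u + 1)), fun v hv =>
      ⟨(h v (by linarith)).1, hf.seminorm_dirDeriv_le hF hp (mem_dom_line h ?_) h3⟩⟩
    have h4 : r / 2 / (q u + 1) * (q u + 1) = r / 2 := by field_simp
    nlinarith

variable [T2Space F]

/-- The increment splits at `x + z • v`. The quotient based at this moving point is controlled by
the locally uniform estimate and by continuity of `d_u f`. -/
theorem IsWeaklyHolomorphic.dirDeriv_add (hf : f.IsWeaklyHolomorphic) (hF : MackeyComplete ℂ F)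
    {x : E} (hx : x ∈ f.dom) (u v : E) :
    (f.dirDeriv ℂ (u + v)).toFun x = (f.dirDeriv ℂ u).toFun x + (f.dirDeriv ℂ v).toFun x := by
  refine tendsto_nhds_unique (hf.tendsto_diffQuot hF hx (u + v)) ?_
  have h1 : Tendsto (fun z : ℂ => f.diffQuot ℂ u (x + z • v) z -
      (f.dirDeriv ℂ u).toFun (x + z • v)) (𝓝[≠] 0) (𝓝 0) := by
    refine tendsto_of_forall_seminorm fun p hp ε hε => ?_
    obtain ⟨R, hR, M, h⟩ := hf.exists_ball_plane hx u v hp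
    have hlim : Tendsto (fun z : ℂ => 4 * M / R ^ 2 * ‖z‖) (𝓝[≠] 0) (𝓝 0) := by
      have hc : Continuous fun z : ℂ => 4 * M / R ^ 2 * ‖z‖ := by fun_prop
      simpa using (hc.tendsto 0).mono_left nhdsWithin_le_nhds
    filter_upwards [hlim.eventually_lt_const hε, self_mem_nhdsWithin,
      nhdsWithin_le_nhds (Metric.ball_mem_nhds 0 hR)] with z h1 h2 h3
    rw [sub_zero]
    exact (hf.seminorm_diffQuot_sub_dirDeriv_le hF hp (h z h3) h3 h2).trans_lt h1
  have h2 : Tendsto (fun z : ℂ => (f.dirDeriv ℂ u).toFun (x + z • v)) (𝓝[≠] 0)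
      (𝓝 ((f.dirDeriv ℂ u).toFun x)) := by
    have hc : Continuous fun z : ℂ => x + z • v := by fun_prop
    have hD := hf.dirDeriv hF u
    have hx' : x ∈ (f.dirDeriv ℂ u).dom := by rwa [hf.dom_dirDeriv hF]
    have h3 := (hD.continuousOn.continuousAt (hD.isOpen_dom.mem_nhds hx')).tendsto.comp
      ((by simpa using hc.tendsto 0 : Tendsto (fun z : ℂ => x + z • v) (𝓝 0) (𝓝 x)))
    exact h3.mono_left nhdsWithin_le_nhds
  have h3 := (h1.add h2).add (hf.tendsto_diffQuot hF hx v)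
  rw [zero_add] at h3
  refine h3.congr fun z => ?_
  rw [sub_add_cancel]
  simp only [diffQuot, ← smul_add, sub_add_sub_cancel]
  rw [add_assoc, add_comm (z • v), smul_add]

theorem IsWeaklyHolomorphic.dirDeriv_smul (hf : f.IsWeaklyHolomorphic) (hF : MackeyComplete ℂ F)
    {x : E} (hx : x ∈ f.dom) (c : ℂ) (u : E) [ContinuousSMul ℂ F] :
    (f.dirDeriv ℂ (c • u)).toFun x = c • (f.dirDeriv ℂ u).toFun x := by
  refine tendsto_nhds_unique (hf.tendsto_diffQuot hF hx (c • u)) ?_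
  rcases eq_or_ne c 0 with rfl | hc
  · simp only [zero_smul]
    exact tendsto_const_nhds.congr fun z => by simp [diffQuot]
  · have h1 : Tendsto (fun z : ℂ => z * c) (𝓝[≠] 0) (𝓝[≠] 0) := by
      refine tendsto_nhdsWithin_of_tendsto_nhds_of_eventually_within _ ?_ ?_
      · have h2 : Continuous fun z : ℂ => z * c := by fun_prop
        simpa using (h2.tendsto 0).mono_left nhdsWithin_le_nhds
      · filter_upwards [self_mem_nhdsWithin] with z hz
        exact mul_ne_zero hz hc
    refine (((hf.tendsto_diffQuot hF hx u).comp h1).const_smul c).congr fun z => ?_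
    simp only [diffQuot, Function.comp_apply, smul_smul]
    congr 1
    rw [mul_inv, mul_comm z⁻¹, mul_inv_cancel_left₀ hc]

theorem dirDeriv_toFun_add (hf : f.IsWeaklyHolomorphic) (h₁ : g₁.IsWeaklyHolomorphic)
    (h₂ : g₂.IsWeaklyHolomorphic) (hF : MackeyComplete ℂ F) (hd₁ : g₁.dom = f.dom)
    (hd₂ : g₂.dom = f.dom) (h : ∀ x ∈ f.dom, f.toFun x = g₁.toFun x + g₂.toFun x)
    {x : E} (hx : x ∈ f.dom) (u : E) :
    (f.dirDeriv ℂ u).toFun x = (g₁.dirDeriv ℂ u).toFun x + (g₂.dirDeriv ℂ u).toFun x := by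
  refine tendsto_nhds_unique_of_eventuallyEq (hf.tendsto_diffQuot hF hx u)
    ((h₁.tendsto_diffQuot hF (hd₁ ▸ hx) u).add (h₂.tendsto_diffQuot hF (hd₂ ▸ hx) u)) ?_
  obtain ⟨R, hR, hl⟩ := exists_ball_line_mem_dom hf.isOpen_dom hx u
  filter_upwards [nhdsWithin_le_nhds (Metric.closedBall_mem_nhds 0 hR)] with z hz
  simp only [diffQuot, h _ (hl z hz), h _ hx, ← smul_add]
  congr 1
  abel

theorem dirDeriv_toFun_smul [ContinuousSMul ℂ F] (hf : f.IsWeaklyHolomorphic)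
    (h₁ : g₁.IsWeaklyHolomorphic) (hF : MackeyComplete ℂ F) (hd₁ : g₁.dom = f.dom) {c : ℂ}
    (h : ∀ x ∈ f.dom, f.toFun x = c • g₁.toFun x) {x : E} (hx : x ∈ f.dom) (u : E) :
    (f.dirDeriv ℂ u).toFun x = c • (g₁.dirDeriv ℂ u).toFun x := by
  refine tendsto_nhds_unique_of_eventuallyEq (hf.tendsto_diffQuot hF hx u)
    ((h₁.tendsto_diffQuot hF (hd₁ ▸ hx) u).const_smul c) ?_
  obtain ⟨R, hR, hl⟩ := exists_ball_line_mem_dom hf.isOpen_dom hx u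
  filter_upwards [nhdsWithin_le_nhds (Metric.closedBall_mem_nhds 0 hR)] with z hz
  simp only [diffQuot, h _ (hl z hz), h _ hx, ← smul_sub]
  exact smul_comm _ _ _

end VectorMap

/-! ### Continuity of bounded multilinear maps. -/

theorem MultilinearMap.continuous_of_seminorm_bound {E F : Type*}
    [AddCommGroup E] [Module ℂ E] [TopologicalSpace E] [IsTopologicalAddGroup E]
    [AddCommGroup F] [Module ℂ F] [TopologicalSpace F] [IsTopologicalAddGroup F]
    [PolynormableSpace ℂ F] {k : ℕ} (m : MultilinearMap ℂ (fun _ : Fin k => E) F)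
    (h : ∀ p : Seminorm ℂ F, Continuous p → ∃ q : Seminorm ℂ E, Continuous q ∧
      ∃ r : ℝ, 0 < r ∧ ∃ M : ℝ, ∀ u : Fin k → E, (∀ i, q (u i) < r) → p (m u) ≤ M) :
    Continuous m := by
  refine continuous_iff_continuousAt.2 fun a => tendsto_of_forall_seminorm fun p hp ε hε => ?_
  obtain ⟨q, hq, r, hr, M, hM⟩ := h p hp
  have hb : ∀ u : Fin k → E, p (m u) ≤ M * ∏ i, (2 / r * q (u i)) := by
    intro u
    -- The positive `η` permits rescaling when `q (u i) = 0`; rescaled vectors have `q`-value at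
    -- most `r / 2`.
    have hη : ∀ η : ℝ, 0 < η → p (m u) ≤ M * ∏ i, (2 / r * (q (u i) + η)) := by
      intro η hη
      have hpos : ∀ i, 0 < 2 / r * (q (u i) + η) := fun i => by
        have := apply_nonneg q (u i)
        positivity
      have hu : u = fun i => ((2 / r * (q (u i) + η) : ℝ) : ℂ) •
          (((2 / r * (q (u i) + η) : ℝ) : ℂ)⁻¹ • u i) := by
        funext i
        rw [smul_inv_smul₀]
        exact_mod_cast (hpos i).ne'
      conv_lhs => rw [hu]
      rw [m.map_smul_univ, map_smul_eq_mul, mul_comm, norm_prod]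
      have : ∏ i, ‖((2 / r * (q (u i) + η) : ℝ) : ℂ)‖ = ∏ i, (2 / r * (q (u i) + η)) :=
        Finset.prod_congr rfl fun i _ => by
          rw [Complex.norm_real, Real.norm_of_nonneg (hpos i).le]
      rw [this]
      refine mul_le_mul_of_nonneg_right (hM _ fun i => ?_)
        (Finset.prod_nonneg fun i _ => (hpos i).le)
      rw [map_smul_eq_mul, norm_inv, Complex.norm_real, Real.norm_of_nonneg (hpos i).le,
        inv_mul_lt_iff₀ (hpos i)]
      have := apply_nonneg q (u i)
      have h4 : 2 / r * (q (u i) + η) * r = 2 * (q (u i) + η) := by field_simp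
      linarith
    have hc : Continuous fun η : ℝ => M * ∏ i, (2 / r * (q (u i) + η)) := by fun_prop
    have hlim := (hc.tendsto 0).mono_left (nhdsWithin_le_nhds (s := Ioi 0))
    simp only [add_zero] at hlim
    exact ge_of_tendsto hlim (by filter_upwards [self_mem_nhdsWithin] with η h using hη η h)
  -- Expanding `m (a + (b - a))` over subsets, every term but `m a` has a factor `q (b i - a i)`,
  -- which vanishes at `b = a`.
  let S : (Fin k → E) → ℝ := fun b => ∑ s ∈ (Finset.univ : Finset (Finset (Fin k))).erase
    Finset.univ, M * ∏ i, (2 / r * if i ∈ s then q (a i) else q (b i - a i))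
  have hS : Continuous S := by
    refine continuous_finsetSum _ fun s _ => continuous_const.mul
      (continuous_finsetProd _ fun i _ => continuous_const.mul ?_)
    split_ifs
    · exact continuous_const
    · fun_prop
  have hSa : S a = 0 := by
    refine Finset.sum_eq_zero fun s hs => ?_
    obtain ⟨i, hi⟩ : ∃ i, i ∉ s := by
      by_contra! hall
      exact (Finset.ne_of_mem_erase hs) (Finset.eq_univ_iff_forall.2 hall)
    rw [Finset.prod_eq_zero (Finset.mem_univ i) (by simp [hi]), mul_zero]
  have hle : ∀ b, p (m b - m a) ≤ S b := by
    intro b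
    have h1 : m b - m a = ∑ s ∈ (Finset.univ : Finset (Finset (Fin k))).erase Finset.univ,
        m (s.piecewise a (b - a)) := by
      conv_lhs => rw [← add_sub_cancel a b, m.map_add_univ]
      rw [← Finset.sum_erase_add _ _ (Finset.mem_univ Finset.univ), Finset.piecewise_univ,
        add_sub_cancel_right]
    rw [h1]
    refine (Finset.le_sum_of_subadditive p (_root_.map_zero p).le
      (map_add_le_add p) _ _).trans (Finset.sum_le_sum fun s _ => ?_)
    refine (hb _).trans_eq ?_
    congr 2 with i
    by_cases hi : i ∈ s <;> simp [hi]
  filter_upwards [(hS.tendsto a).eventually_lt_const (by rwa [hSa] : S a < ε)] with b hb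
  exact (hle b).trans_lt hb

/-! ### Iterated derivatives and the Keller class. -/

namespace VectorMap

variable {E F : Type*} [AddCommGroup E] [Module ℂ E] [TopologicalSpace E]
  [IsTopologicalAddGroup E] [ContinuousSMul ℂ E]
  [AddCommGroup F] [Module ℂ F] [TopologicalSpace F] [IsTopologicalAddGroup F]
  [PolynormableSpace ℂ F]
  {f : VectorMap E F} (hf : f.IsWeaklyHolomorphic) (hF : MackeyComplete ℂ F)
include hf hF

theorem IsWeaklyHolomorphic.iterDirDeriv_and_dom (k : ℕ) (u : Fin k → E) :
    (f.iterDirDeriv ℂ k u).IsWeaklyHolomorphic ∧ (f.iterDirDeriv ℂ k u).dom = f.dom := by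
  induction k with
  | zero => exact ⟨hf, rfl⟩
  | succ k ih =>
    have h := ih (Fin.init u)
    exact ⟨h.1.dirDeriv hF _, (h.1.dom_dirDeriv hF _).trans h.2⟩

theorem IsWeaklyHolomorphic.iterDirDeriv (k : ℕ) (u : Fin k → E) :
    (f.iterDirDeriv ℂ k u).IsWeaklyHolomorphic :=
  (hf.iterDirDeriv_and_dom hF k u).1

theorem IsWeaklyHolomorphic.dom_iterDirDeriv (k : ℕ) (u : Fin k → E) :
    (f.iterDirDeriv ℂ k u).dom = f.dom :=
  (hf.iterDirDeriv_and_dom hF k u).2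

/-- Each order costs one Cauchy estimate on the unit disc in the last direction: `q` stays, `r` is
halved, `M` is doubled. -/
theorem IsWeaklyHolomorphic.iterDirDeriv_bound {p : Seminorm ℂ F} (hp : Continuous p) {x : E}
    (hx : x ∈ f.dom) (k : ℕ) : ∃ q : Seminorm ℂ E, Continuous q ∧ ∃ r : ℝ, 0 < r ∧ ∃ M : ℝ,
      ∀ u : Fin k → E, (∀ i, q (u i) < r) → ∀ v, q v < r →
        x + v ∈ f.dom ∧ p ((f.iterDirDeriv ℂ k u).toFun (x + v)) ≤ M := by
  induction k with
  | zero =>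
    obtain ⟨q, hq, r, hr, M, h⟩ := hf.locally_bounded p hp x hx
    exact ⟨q, hq, r, hr, M, fun u _ v hv => h v hv⟩
  | succ k ih =>
    obtain ⟨q, hq, r, hr, M, h⟩ := ih
    refine ⟨q, hq, r / 2, by positivity, 2 * M / 1, fun u hu v hv => ?_⟩
    have h1 := h (Fin.init u) fun i => (hu i.castSucc).trans (by linarith)
    refine ⟨(h1 v (by linarith)).1,
      (hf.iterDirDeriv hF k (Fin.init u)).seminorm_dirDeriv_le hF hp ?_ one_pos⟩
    rw [← hf.dom_iterDirDeriv hF k (Fin.init u)] at h1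
    exact mem_dom_line h1 (by linarith [hu (Fin.last k)])

variable [T2Space F]

/-- The last slot is additivity of a single derivative; in earlier slots the inductive identity,
valid on the whole domain, is differentiated. Symmetry of mixed derivatives plays no role. -/
theorem IsWeaklyHolomorphic.iterDirDeriv_update_add (k : ℕ) (u : Fin k → E) (i : Fin k)
    (a b : E) {x : E} (hx : x ∈ f.dom) :
    (f.iterDirDeriv ℂ k (Function.update u i (a + b))).toFun x =
      (f.iterDirDeriv ℂ k (Function.update u i a)).toFun x +
        (f.iterDirDeriv ℂ k (Function.update u i b)).toFun x := by
  induction k generalizing x with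
  | zero => exact i.elim0
  | succ k ih =>
    simp only [VectorMap.iterDirDeriv]
    cases i using Fin.lastCases with
    | last =>
      simp only [Fin.init_update_last, Function.update_self]
      exact (hf.iterDirDeriv hF k _).dirDeriv_add hF (by rwa [hf.dom_iterDirDeriv hF]) a b
    | cast i =>
      simp only [Fin.init_update_castSucc,
        Function.update_of_ne (Fin.castSucc_lt_last i).ne']
      refine dirDeriv_toFun_add (hf.iterDirDeriv hF k _) (hf.iterDirDeriv hF k _)
        (hf.iterDirDeriv hF k _) hF ?_ ?_ (fun y hy => ?_) ?_ _
      · simp only [hf.dom_iterDirDeriv hF]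
      · simp only [hf.dom_iterDirDeriv hF]
      · rw [hf.dom_iterDirDeriv hF] at hy
        exact ih _ i hy
      · rwa [hf.dom_iterDirDeriv hF]

variable [ContinuousSMul ℂ F]

theorem IsWeaklyHolomorphic.iterDirDeriv_update_smul (k : ℕ) (u : Fin k → E) (i : Fin k)
    (c : ℂ) (a : E) {x : E} (hx : x ∈ f.dom) :
    (f.iterDirDeriv ℂ k (Function.update u i (c • a))).toFun x =
      c • (f.iterDirDeriv ℂ k (Function.update u i a)).toFun x := by
  induction k generalizing x with
  | zero => exact i.elim0
  | succ k ih =>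
    simp only [VectorMap.iterDirDeriv]
    cases i using Fin.lastCases with
    | last =>
      simp only [Fin.init_update_last, Function.update_self]
      exact (hf.iterDirDeriv hF k _).dirDeriv_smul hF (by rwa [hf.dom_iterDirDeriv hF]) c a
    | cast i =>
      simp only [Fin.init_update_castSucc,
        Function.update_of_ne (Fin.castSucc_lt_last i).ne']
      refine dirDeriv_toFun_smul (hf.iterDirDeriv hF k _) (hf.iterDirDeriv hF k _) hF ?_
        (fun y hy => ?_) ?_ _
      · simp only [hf.dom_iterDirDeriv hF]
      · rw [hf.dom_iterDirDeriv hF] at hy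
        exact ih _ i hy
      · rwa [hf.dom_iterDirDeriv hF]

theorem IsWeaklyHolomorphic.exists_multilinearMap (k : ℕ) {x : E} (hx : x ∈ f.dom) :
    ∃ m : MultilinearMap ℂ (fun _ : Fin k => E) F, ∀ u, m u = f.variation ℂ k x u :=
  ⟨{ toFun := f.variation ℂ k x
     map_update_add' := fun {inst} u i a b => by
       -- The axioms of `MultilinearMap` quantify over arbitrary decidability instances.
       rw [Subsingleton.elim inst (instDecidableEqFin k)]
       exact hf.iterDirDeriv_update_add hF k u i a b hx
     map_update_smul' := fun {inst} u i c a => by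
       rw [Subsingleton.elim inst (instDecidableEqFin k)]
       exact hf.iterDirDeriv_update_smul hF k u i c a hx }, fun _ => rfl⟩

theorem IsWeaklyHolomorphic.isKellerPi : f.IsKellerPi ℂ ⊤ where
  isOpen_dom := hf.isOpen_dom
  differentialDom_eq k _ := by
    refine Subset.antisymm (fun x hx => ?_) fun x hx =>
      ⟨fun u => by rwa [hf.dom_iterDirDeriv hF], hf.exists_multilinearMap hF k hx⟩
    rw [← hf.dom_iterDirDeriv hF k 0]
    exact hx.1 0
  continuous_variation k _ x hx := by
    obtain ⟨m, hm⟩ := hf.exists_multilinearMap hF k hx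
    rw [← funext hm]
    refine m.continuous_of_seminorm_bound fun p hp => ?_
    obtain ⟨q, hq, r, hr, M, h⟩ := hf.iterDirDeriv_bound hF hp hx k
    refine ⟨q, hq, r, hr, M, fun u hu => ?_⟩
    rw [hm]
    simpa [variation] using (h u hu 0 (by simpa using hr)).2
  differential_limContinuous k _ x hx W hW := by
    obtain ⟨p, hp, s, hs, hpW⟩ := exists_seminorm_ball_subset hW
    obtain ⟨q, hq, r, hr, M, h⟩ := hf.iterDirDeriv_bound hF hp hx k
    refine ⟨{u | q u < r}, (hq.tendsto 0).eventually_lt_const (by simpa using hr),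
      fun ε hε => ?_⟩
    -- Only `R`, and so `V`, depends on `ε`; `U` is already fixed by the uniform bound.
    obtain ⟨R, hR1, hR2⟩ : ∃ R : ℝ, 1 < R ∧ 2 * M / R < ε * s :=
      ((eventually_gt_atTop 1).and ((tendsto_const_nhds.div_atTop
        tendsto_id).eventually_lt_const (mul_pos hε hs))).exists
    have hc : Continuous fun v => R * q v := by fun_prop
    refine ⟨{v | R * q v < r}, (hc.tendsto 0).eventually_lt_const (by simpa using hr),
      fun v hv => ⟨(h 0 (by simp [hr]) v ?_).1, fun u hu => ?_⟩⟩
    · exact (le_mul_of_one_le_left (apply_nonneg q v) hR1.le).trans_lt hv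
    · have h1 := h u hu
      rw [← hf.dom_iterDirDeriv hF k u] at h1
      have h2 := (hf.iterDirDeriv hF k u).seminorm_sub_le_of_ball hp h1 hR1 hv
      have hε' : (ε : ℂ) ≠ 0 := by exact_mod_cast hε.ne'
      refine (mem_smul_set_iff_inv_smul_mem₀ hε' _ _).2 (hpW _ ?_)
      rw [map_smul_eq_mul, norm_inv, Complex.norm_real, Real.norm_of_nonneg hε.le,
        inv_mul_lt_iff₀ hε]
      exact h2.trans_lt hR2

omit hf hF [PolynormableSpace ℂ F] [T2Space F] in
-- Continuity supplies the local bound `p (f x) + 1`; functionals carry limits of quotients to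
-- scalar derivatives.
theorem IsHolomorphicT.isWeaklyHolomorphic [PolynormableSpace ℂ E] (hf : f.IsHolomorphicT) :
    f.IsWeaklyHolomorphic := by
  obtain ⟨ho, hc⟩ := (isKellerPi_zero_iff ℂ f).1 hf.isKellerPi_zero
  refine ⟨ho, fun φ x hx u => ?_, fun p hp x hx => ?_⟩
  · have hmem : (x, u) ∈ {p : E × E | p.1 ∈ (f.dirDeriv ℂ p.2).dom} := by
      rw [hf.directionallyDifferentiable]
      exact ⟨hx, mem_univ u⟩
    obtain ⟨-, -, y, hy⟩ := hmem
    rw [dirFilter_eq ho hx] at hy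
    refine HasDerivAt.differentiableAt (f' := φ y) ?_
    rw [hasDerivAt_iff_tendsto_slope_zero]
    refine ((φ.continuous.tendsto y).comp hy).congr fun z => ?_
    simp [diffQuot]
  · have h1 : Tendsto (fun v : E => x + v) (𝓝 0) (𝓝 x) := by
      have h : Continuous fun v : E => x + v := by fun_prop
      simpa using h.tendsto 0
    have h2 := (hp.tendsto _).comp ((hc.continuousAt (ho.mem_nhds hx)).tendsto.comp h1)
    obtain ⟨q, hq, r, hr, h⟩ := exists_seminorm_ball_subset
      ((h1.eventually (ho.mem_nhds hx)).and
        (h2.eventually_le_const (lt_add_one (p (f.toFun x)))))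
    exact ⟨q, hq, r, hr, _, h⟩

end VectorMap

theorem theorem3p8 {E F : Type*}
    [AddCommGroup E] [Module ℂ E] [TopologicalSpace E] [IsTopologicalAddGroup E]
    [ContinuousSMul ℂ E] [LocallyConvexSpace ℝ E] [T2Space E]
    [AddCommGroup F] [Module ℂ F] [TopologicalSpace F] [IsTopologicalAddGroup F]
    [ContinuousSMul ℂ F] [LocallyConvexSpace ℝ F] [T2Space F]
    (f : VectorMap E F) (hf : f.IsHolomorphicT) :
    f.IsKellerPi ℂ ⊤ := by
  have := polynormableSpace_complex (E := E)
  have := polynormableSpace_complex (E := F)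
  exact hf.isWeaklyHolomorphic.isKellerPi hf.mackeyComplete
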